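/- Let $n\ge 1$ be an integer, let $Q=2n+2$ be the homogeneous dimension of the Heisenberg group $\mathbb H^n$, whose points are written in logarithmic coordinates as $(z,\sigma)\in\mathbb R^{2n}\times\mathbb R$, and let $1<p<Q$. Let $N(z,\sigma)=(|z|^4+16|\sigma|^2)^{1/4}$ be the Korányi–Folland gauge and, for $t>0$, let $$G_p((z,\sigma),t)=t^{-\frac{Q+p-2}{2(p-1)}}\int_{\mathbb R}e^{-\frac{i}{(p-1)t}\sigma\lambda}\left(\frac{|\lambda|}{\sinh|\lambda|}\right)^{\frac{Q-p}{2(p-1)}}e^{-\frac{|z|^2}{4(p-1)t}\frac{|\lambda|}{\tanh|\lambda|}}\,d\lambda .$$ Put $\alpha=\frac{Q-p}{2(p-1)}$ and $$C_{n,p}=2^{3\alpha-1}(p-1)^{\alpha}\,\Gamma\!\left(\frac{\alpha}{2}\right)^2>0 .$$ Then for every $(z,\sigma)\neq(0,0)$ the integral defining $G_p((z,\sigma),t)$ converges absolutely for all $t>0$, the function $t\mapsto G_p((z,\sigma),t)$ is absolutely integrable on $(0,\infty)$, and $$\int_0^\infty G_p((z,\sigma),t)\,dt=C_{n,p}\,N(z,\sigma)^{-\frac{Q-p}{p-1}}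 .$$ -/

import Mathlib

open MeasureTheory Set

noncomputable section

namespace Heisenberg

/-- The horizontal layer `ℝ²ⁿ` of the Heisenberg group `ℍⁿ`, with its Euclidean norm. A point of
`ℍⁿ` is written in logarithmic coordinates as a pair `(z, σ)` with `z` in this space and `σ` in the
one-dimensional vertical layer `ℝ`. -/
abbrev Horizontal (n : ℕ) : Type := EuclideanSpace ℝ (Fin (2 * n))

/-- The homogeneous dimension `Q = 2n + 2` of `ℍⁿ`. -/
def homDim (n : ℕ) : ℝ := 2 * (n : ℝ) + 2

/-- The Korányi-Folland gauge `N(z, σ) = (|z|⁴ + 16 |σ|²)^(1/4)`. -/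
def gauge {n : ℕ} (z : Horizontal n) (σ : ℝ) : ℝ :=
  (‖z‖ ^ 4 + 16 * |σ| ^ 2) ^ ((1 : ℝ) / 4)

/-- The integrand (in the dual variable `l`) of the Fourier integral defining the kernel `G_p`.
At the single point `l = 0` the quotients `|l| / sinh |l|` and `|l| / tanh |l|` should be read as
their limit `1`; Lean assigns them the value `0` there, which does not affect any integral over
`l`. -/
def kernelIntegrand {n : ℕ} (p : ℝ) (z : Horizontal n) (σ t l : ℝ) : ℂ :=
  Complex.exp (-(Complex.I / (((p - 1) * t : ℝ) : ℂ)) * ((σ * l : ℝ) : ℂ))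
    * (((|l| / Real.sinh |l|) ^ ((homDim n - p) / (2 * (p - 1))) : ℝ) : ℂ)
    * ((Real.exp (-(‖z‖ ^ 2 / (4 * (p - 1) * t)) * (|l| / Real.tanh |l|)) : ℝ) : ℂ)

/-- The kernel `G_p((z, σ), t)`, for `t > 0` and `1 < p < Q`. -/
def kernel {n : ℕ} (p : ℝ) (z : Horizontal n) (σ t : ℝ) : ℂ :=
  ((t ^ (-((homDim n + p - 2) / (2 * (p - 1)))) : ℝ) : ℂ) * ∫ l : ℝ, kernelIntegrand p z σ t l

/-- The constant `C_{n,p} = 2^(3α - 1) (p - 1)^α Γ(α / 2)²` with `α = (Q - p) / (2 (p - 1))`. -/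
def potentialConst (n : ℕ) (p : ℝ) : ℝ :=
  2 ^ (3 * ((homDim n - p) / (2 * (p - 1))) - 1)
    * (p - 1) ^ ((homDim n - p) / (2 * (p - 1)))
    * Real.Gamma ((homDim n - p) / (2 * (p - 1)) / 2) ^ 2

end Heisenberg

end

open Filter Topology

namespace Heisenberg

/-! Put `α = (Q - p) / (2 (p - 1))`, `S w = sinh w / w` and `|z|² + 4iσ = R e^{iθ}`, so that `R =
N²` and `|θ| ≤ π/2`. Up to the power of `t`, the kernel is the integral over the real line of
`S^(-α) exp(-((|z|² cosh w + 4iσ sinh w) / S) / (4 (p - 1) t))`. This is holomorphic on the closed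
strip `|Im w| ≤ π/2`, where `Re S > 0` (`sinhc_re_pos`). Since `|z|² cosh w + 4iσ sinh w = R cosh (w
+ iθ)`, moving the line to `Im w = -θ` turns this numerator into the real number `R cosh x`
(`integral_stripIntegrand_shift`, `stripIntegrand_shift`).

On the new line the double integral converges absolutely (`integrable_shiftedIntegrand`), which
fails on the real line when `z = 0`, the exponential then being purely oscillatory. Integrating in
`t` first gives a Gamma integral (`integral_rpow_mul_cexp_div`) in which the powers of `S` cancel.
What remains is a multiple of `∫ (cosh x)^(-α)`, a Beta integral (`integral_cosh_rpow_neg`). -/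

/-! ### Estimates for `sinh w / w` on the strip `|Im w| ≤ π/2` -/

/-- The entire function `sinh z / z`. -/
noncomputable def sinhc : ℂ → ℂ := dslope Complex.sinh 0

lemma sinhc_zero : sinhc 0 = 1 := by
  simp [sinhc, dslope_same]

lemma sinhc_of_ne_zero {w : ℂ} (hw : w ≠ 0) : sinhc w = Complex.sinh w / w := by
  rw [sinhc, dslope_of_ne _ hw, slope_def_field]
  simp

lemma sinhc_mul_self (w : ℂ) : sinhc w * w = Complex.sinh w := by
  rcases eq_or_ne w 0 with rfl | hw
  · simp
  · rw [sinhc_of_ne_zero hw, div_mul_cancel₀ _ hw]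

lemma differentiable_sinhc : Differentiable ℂ sinhc := by
  rw [← differentiableOn_univ, sinhc, Complex.differentiableOn_dslope univ_mem]
  exact Complex.differentiable_sinh.differentiableOn

lemma sinh_re (w : ℂ) : (Complex.sinh w).re = Real.sinh w.re * Real.cos w.im := by
  conv_lhs => rw [← Complex.re_add_im w]
  rw [Complex.sinh_add, Complex.cosh_mul_I, Complex.sinh_mul_I, ← Complex.ofReal_sinh,
    ← Complex.ofReal_cosh, ← Complex.ofReal_cos, ← Complex.ofReal_sin]
  simp only [Complex.add_re, Complex.mul_re, Complex.mul_im, Complex.ofReal_re,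
    Complex.ofReal_im, Complex.I_re, Complex.I_im]
  ring

lemma sinh_im (w : ℂ) : (Complex.sinh w).im = Real.cosh w.re * Real.sin w.im := by
  conv_lhs => rw [← Complex.re_add_im w]
  rw [Complex.sinh_add, Complex.cosh_mul_I, Complex.sinh_mul_I, ← Complex.ofReal_sinh,
    ← Complex.ofReal_cosh, ← Complex.ofReal_cos, ← Complex.ofReal_sin]
  simp only [Complex.add_im, Complex.mul_re, Complex.mul_im, Complex.ofReal_re,
    Complex.ofReal_im, Complex.I_re, Complex.I_im]
  ring

lemma cosh_re (w : ℂ) : (Complex.cosh w).re = Real.cosh w.re * Real.cos w.im := by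
  conv_lhs => rw [← Complex.re_add_im w]
  rw [Complex.cosh_add, Complex.cosh_mul_I, Complex.sinh_mul_I, ← Complex.ofReal_sinh,
    ← Complex.ofReal_cosh, ← Complex.ofReal_cos, ← Complex.ofReal_sin]
  simp only [Complex.add_re, Complex.mul_re, Complex.mul_im, Complex.ofReal_re,
    Complex.ofReal_im, Complex.I_re, Complex.I_im]
  ring

lemma cosh_im (w : ℂ) : (Complex.cosh w).im = Real.sinh w.re * Real.sin w.im := by
  conv_lhs => rw [← Complex.re_add_im w]
  rw [Complex.cosh_add, Complex.cosh_mul_I, Complex.sinh_mul_I, ← Complex.ofReal_sinh,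
    ← Complex.ofReal_cosh, ← Complex.ofReal_cos, ← Complex.ofReal_sin]
  simp only [Complex.add_im, Complex.mul_re, Complex.mul_im, Complex.ofReal_re,
    Complex.ofReal_im, Complex.I_re, Complex.I_im]
  ring

lemma mul_sinh_nonneg (x : ℝ) : 0 ≤ x * Real.sinh x := by
  rcases le_total 0 x with h | h
  · exact mul_nonneg h (Real.sinh_nonneg_iff.2 h)
  · exact mul_nonneg_of_nonpos_of_nonpos h (Real.sinh_nonpos_iff.2 h)

lemma mul_sin_nonneg {y : ℝ} (hy : |y| ≤ Real.pi) : 0 ≤ y * Real.sin y := by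
  obtain ⟨h1, h2⟩ := abs_le.1 hy
  rcases le_total 0 y with h | h
  · exact mul_nonneg h (Real.sin_nonneg_of_nonneg_of_le_pi h h2)
  · exact mul_nonneg_of_nonpos_of_nonpos h (Real.sin_nonpos_of_nonpos_of_neg_pi_le h h1)

lemma sinhc_re_mul_normSq (w : ℂ) : (sinhc w).re * Complex.normSq w =
    w.re * Real.sinh w.re * Real.cos w.im + w.im * Real.sin w.im * Real.cosh w.re := by
  have h : (sinhc w).re * Complex.normSq w = (Complex.sinh w * (starRingEnd ℂ) w).re := by
    rw [← sinhc_mul_self, mul_assoc, Complex.mul_conj, Complex.re_mul_ofReal]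
  rw [h, Complex.mul_re, sinh_re, sinh_im]
  simp
  ring

/-- In `sinhc_re_mul_normSq` both terms are nonnegative on the strip, and they do not vanish
together unless `w = 0`. Positivity keeps the principal power of `sinhc` holomorphic up to the
boundary of the strip. -/
lemma sinhc_re_pos {w : ℂ} (hw : |w.im| ≤ Real.pi / 2) : 0 < (sinhc w).re := by
  rcases eq_or_ne w 0 with rfl | h0
  · simp [sinhc_zero]
  refine pos_of_mul_pos_left ?_ (Complex.normSq_nonneg w)
  rw [sinhc_re_mul_normSq]
  have hpi := Real.pi_pos
  obtain ⟨h1, h2⟩ := abs_le.1 hw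
  have hcos : 0 ≤ Real.cos w.im := Real.cos_nonneg_of_neg_pi_div_two_le_of_le h1 h2
  have hs : 0 ≤ w.im * Real.sin w.im := mul_sin_nonneg (by linarith)
  have hx : 0 ≤ w.re * Real.sinh w.re := mul_sinh_nonneg _
  have hc := Real.cosh_pos w.re
  by_cases hy : w.im = 0
  · have hxr : w.re ≠ 0 := fun h => h0 (Complex.ext h hy)
    have : 0 < w.re * Real.sinh w.re :=
      lt_of_le_of_ne hx (mul_ne_zero hxr (by simpa [Real.sinh_eq_zero] using hxr)).symm
    simpa [hy] using this
  · have hsin : Real.sin w.im ≠ 0 := by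
      intro h
      exact hy ((Real.sin_eq_zero_iff_of_lt_of_lt (by linarith) (by linarith)).1 h)
    have : 0 < w.im * Real.sin w.im := lt_of_le_of_ne hs (mul_ne_zero hy hsin).symm
    positivity

lemma sinhc_ne_zero {w : ℂ} (hw : |w.im| ≤ Real.pi / 2) : sinhc w ≠ 0 := by
  intro h
  have := sinhc_re_pos hw
  simp [h] at this

lemma sinhc_mem_slitPlane {w : ℂ} (hw : |w.im| ≤ Real.pi / 2) : sinhc w ∈ Complex.slitPlane :=
  Or.inl (sinhc_re_pos hw)

lemma normSq_sinh (w : ℂ) :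
    Complex.normSq (Complex.sinh w) = Real.sinh w.re ^ 2 + Real.sin w.im ^ 2 := by
  rw [Complex.normSq_apply, sinh_re, sinh_im]
  have := Real.cosh_sq w.re
  have := Real.sin_sq_add_cos_sq w.im
  grind

lemma normSq_cosh (w : ℂ) :
    Complex.normSq (Complex.cosh w) = Real.sinh w.re ^ 2 + Real.cos w.im ^ 2 := by
  rw [Complex.normSq_apply, cosh_re, cosh_im]
  have := Real.cosh_sq w.re
  have := Real.sin_sq_add_cos_sq w.im
  grind

lemma sq_le_sinh_sq (x : ℝ) : x ^ 2 ≤ Real.sinh x ^ 2 := by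
  rw [sq_le_sq, Real.abs_sinh]
  exact Real.self_le_sinh_iff.2 (abs_nonneg x)

/-- The double-angle formula splits `|sinh w|²` into a factor that absorbs `|w|²` and a factor that
grows like `cosh² (Re w / 2)`. The constant `1/3` is not sharp. -/
lemma cosh_half_le_norm_sinhc {w : ℂ} (hw : |w.im| ≤ Real.pi / 2) :
    Real.cosh (w.re / 2) / 3 ≤ ‖sinhc w‖ := by
  rcases eq_or_ne w 0 with rfl | h0
  · norm_num [sinhc_zero]
  have hn : 0 < Complex.normSq w := Complex.normSq_pos.2 h0
  have hpi := Real.pi_gt_three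
  have hpi4 := Real.pi_lt_d2
  obtain ⟨h1, h2⟩ := abs_le.1 hw
  refine le_of_abs_le (abs_le_of_sq_le_sq ?_ (norm_nonneg _))
  rw [← Complex.normSq_eq_norm_sq]
  refine le_of_mul_le_mul_right ?_ hn
  rw [← map_mul, sinhc_mul_self]
  have hdouble : Complex.normSq (Complex.sinh w) =
      4 * (Real.sinh (w.re / 2) ^ 2 + Real.sin (w.im / 2) ^ 2) *
        (Real.sinh (w.re / 2) ^ 2 + Real.cos (w.im / 2) ^ 2) := by
    have h : Complex.sinh w = 2 * Complex.sinh (w / 2) * Complex.cosh (w / 2) := by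
      rw [← Complex.sinh_two_mul, mul_div_cancel₀ _ two_ne_zero]
    rw [h, map_mul, map_mul, normSq_sinh, normSq_cosh]
    norm_num [Complex.normSq_apply]
  rw [hdouble, Complex.normSq_apply]
  have hsinh := sq_le_sinh_sq (w.re / 2)
  have hsin : (2 / Real.pi * |w.im / 2|) ^ 2 ≤ Real.sin (w.im / 2) ^ 2 := by
    rw [← sq_abs (Real.sin _)]
    refine pow_le_pow_left₀ (by positivity) (Real.mul_abs_le_abs_sin ?_) 2
    rw [abs_le]; constructor <;> linarith
  -- Jordan's inequality, with `4 / π² ≥ 4 / 10`.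
  have hsin' : (w.im / 2) ^ 2 * (4 / 10) ≤ Real.sin (w.im / 2) ^ 2 := by
    refine le_trans ?_ hsin
    rw [mul_pow, sq_abs, mul_comm]
    gcongr
    rw [div_pow, div_le_div_iff₀ (by norm_num) (by positivity)]
    nlinarith
  have hcos : 1 / 2 ≤ Real.cos (w.im / 2) ^ 2 := by
    rw [Real.cos_sq, mul_div_cancel₀ _ two_ne_zero]
    have := Real.cos_nonneg_of_neg_pi_div_two_le_of_le h1 h2
    linarith
  have hcosh := Real.cosh_sq (w.re / 2)
  have e1 : (w.re * w.re + w.im * w.im) * (1 / 10) ≤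
      Real.sinh (w.re / 2) ^ 2 + Real.sin (w.im / 2) ^ 2 := by nlinarith
  have e2 : Real.cosh (w.re / 2) ^ 2 / 2 ≤
      Real.sinh (w.re / 2) ^ 2 + Real.cos (w.im / 2) ^ 2 := by nlinarith
  have e3 : (w.re * w.re + w.im * w.im) * (1 / 10) * (Real.cosh (w.re / 2) ^ 2 / 2) ≤ _ :=
    mul_le_mul e1 e2 (by positivity) (by positivity)
  have : 0 ≤ (w.re * w.re + w.im * w.im) * Real.cosh (w.re / 2) ^ 2 :=
    mul_nonneg (by nlinarith) (by positivity)
  nlinarith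

/-- With `w = x + iy`, the real part of `w cosh w` times the conjugate of `sinh w` is `x sinh x cosh
x + y sin y cos y`. -/
lemma cosh_div_sinhc_re_nonneg {w : ℂ} (hw : |w.im| ≤ Real.pi / 2) :
    0 ≤ (Complex.cosh w / sinhc w).re := by
  rcases eq_or_ne w 0 with rfl | h0
  · simp [sinhc_zero]
  have hs : Complex.sinh w ≠ 0 := by
    rw [← sinhc_mul_self]; exact mul_ne_zero (sinhc_ne_zero hw) h0
  have hpi := Real.pi_pos
  have e : (Complex.cosh w / sinhc w) = w * (Complex.cosh w * (starRingEnd ℂ) (Complex.sinh w)) *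
      ((Complex.normSq (Complex.sinh w))⁻¹ : ℝ) := by
    rw [sinhc_of_ne_zero h0, div_div_eq_mul_div, div_eq_mul_inv, Complex.inv_def]
    ring
  rw [e, Complex.re_mul_ofReal]
  refine mul_nonneg ?_ (inv_nonneg.2 (Complex.normSq_nonneg _))
  simp only [Complex.mul_re, Complex.mul_im, Complex.conj_re, Complex.conj_im, sinh_re, sinh_im,
    cosh_re, cosh_im]
  have h2 : 0 ≤ w.re * Real.sinh w.re * Real.cosh w.re :=
    mul_nonneg (mul_sinh_nonneg _) (Real.cosh_pos _).le
  have h3 : 0 ≤ w.im * Real.sin w.im * Real.cos w.im :=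
    mul_nonneg (mul_sin_nonneg (by linarith))
      (Real.cos_nonneg_of_neg_pi_div_two_le_of_le (abs_le.1 hw).1 (abs_le.1 hw).2)
  convert add_nonneg h2 h3 using 1
  linear_combination (w.re * Real.sinh w.re * Real.cosh w.re) * Real.sin_sq_add_cos_sq w.im +
    (w.im * Real.sin w.im * Real.cos w.im) * Real.cosh_sq w.re

/-- On a horizontal line in the strip the argument of `sinhc` approaches `±π/2` at most
slowly. -/
lemma exists_le_sinhc_re_div_norm {y : ℝ} (hy : |y| ≤ Real.pi / 2) :
    ∃ k : ℝ, 0 < k ∧ ∀ x : ℝ, k / Real.cosh (x / 2) * ‖sinhc (x + y * Complex.I)‖ ≤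
      (sinhc (x + y * Complex.I)).re := by
  rcases eq_or_ne y 0 with rfl | hy0
  -- The general witness `y sin y / 4` vanishes at `y = 0`, but there `sinhc` is real and positive.
  · refine ⟨1, one_pos, fun x => ?_⟩
    have hre : sinhc (x + (0 : ℝ) * Complex.I) = ((sinhc (x + (0 : ℝ) * Complex.I)).re : ℂ) := by
      rcases eq_or_ne x 0 with rfl | hx
      · simp [sinhc_zero]
      · have : (x : ℂ) ≠ 0 := by exact_mod_cast hx
        simp [sinhc_of_ne_zero this, ← Complex.ofReal_sinh, ← Complex.ofReal_div]
    have hpos := sinhc_re_pos (w := x + (0 : ℝ) * Complex.I) (by simpa using hy)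
    have hn : ‖sinhc (x + (0 : ℝ) * Complex.I)‖ = (sinhc (x + (0 : ℝ) * Complex.I)).re := by
      rw [hre, Complex.norm_real, Complex.ofReal_re, Real.norm_of_nonneg hpos.le]
    rw [hn]
    exact mul_le_of_le_one_left hpos.le (div_le_one_of_le₀ (Real.one_le_cosh _) (Real.cosh_pos _).le)
  have hpi := Real.pi_gt_three
  have hpi4 := Real.pi_lt_d2
  obtain ⟨h1, h2⟩ := abs_le.1 hy
  have hsin : Real.sin y ≠ 0 := fun h =>
    hy0 ((Real.sin_eq_zero_iff_of_lt_of_lt (by linarith) (by linarith)).1 h)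
  have hk : 0 < y * Real.sin y :=
    lt_of_le_of_ne (mul_sin_nonneg (by linarith)) (mul_ne_zero hy0 hsin).symm
  -- Combines `Re (sinhc w) |w|² ≥ y sin y cosh x`, `|sinhc w| |w| ≤ cosh x` and `|w| ≤ 4 cosh (x /
  -- 2)`; the last gives the `4`.
  refine ⟨y * Real.sin y / 4, by positivity, fun x => ?_⟩
  set w : ℂ := x + y * Complex.I with hwdef
  have hwre : w.re = x := by simp [hwdef]
  have hwim : w.im = y := by simp [hwdef]
  have hn : 0 < Complex.normSq w := by
    rw [Complex.normSq_pos]; intro h; apply hy0; rw [← hwim, h]; rfl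
  have hc := Real.cosh_pos x
  have hc2 := Real.cosh_pos (x / 2)
  have hcc : 1 ≤ Real.cosh (x / 2) := Real.one_le_cosh _
  have hnorm : ‖sinhc w‖ * ‖w‖ ≤ Real.cosh x := by
    rw [← norm_mul, sinhc_mul_self]
    refine le_of_abs_le (abs_le_of_sq_le_sq ?_ hc.le)
    rw [← Complex.normSq_eq_norm_sq, normSq_sinh, Real.cosh_sq, hwre]
    have := Real.sin_sq_le_one w.im
    linarith
  have hw4 : ‖w‖ ≤ 4 * Real.cosh (x / 2) := by
    refine le_of_abs_le (abs_le_of_sq_le_sq ?_ (by positivity))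
    rw [← Complex.normSq_eq_norm_sq, Complex.normSq_apply, hwre, hwim]
    have a1 := sq_le_sinh_sq (x / 2)
    have a2 := Real.cosh_sq (x / 2)
    nlinarith
  refine le_of_mul_le_mul_right ?_ hn
  rw [sinhc_re_mul_normSq, hwre, hwim]
  have hcos : 0 ≤ Real.cos y := Real.cos_nonneg_of_neg_pi_div_two_le_of_le h1 h2
  have hx := mul_nonneg (mul_sinh_nonneg x) hcos
  calc y * Real.sin y / 4 / Real.cosh (x / 2) * ‖sinhc w‖ * Complex.normSq w
      = y * Real.sin y / 4 / Real.cosh (x / 2) * ((‖sinhc w‖ * ‖w‖) * ‖w‖) := by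
        rw [Complex.normSq_eq_norm_sq]; ring
    _ ≤ y * Real.sin y / 4 / Real.cosh (x / 2) * (Real.cosh x * (4 * Real.cosh (x / 2))) := by
        gcongr
    _ = y * Real.sin y * Real.cosh x := by field_simp
    _ ≤ _ := by linarith

/-! ### Contour shift -/

/-- Shift of the line of integration within a horizontal strip. -/
lemma integral_add_mul_I_eq {f : ℂ → ℂ} {y : ℝ} {B : ℝ → ℝ}
    (hf : ∀ w : ℂ, w.im ∈ uIcc 0 y → DifferentiableAt ℂ f w)
    (hB : ∀ w : ℂ, w.im ∈ uIcc 0 y → ‖f w‖ ≤ B w.re)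
    (hBi : Integrable B) (hBtop : Tendsto B atTop (𝓝 0)) (hBbot : Tendsto B atBot (𝓝 0)) :
    ∫ x : ℝ, f x = ∫ x : ℝ, f (x + y * Complex.I) := by
  have hcont : ∀ v ∈ uIcc 0 y, Continuous fun x : ℝ => f (x + v * Complex.I) := by
    intro v hv
    rw [continuous_iff_continuousAt]
    intro x
    have := (hf (x + v * Complex.I) (by simpa using hv)).continuousAt
    exact ContinuousAt.comp (f := fun x : ℝ => (x + v * Complex.I : ℂ)) this
      (by fun_prop)
  have hint : ∀ v ∈ uIcc 0 y, Integrable fun x : ℝ => f (x + v * Complex.I) := by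
    intro v hv
    refine hBi.mono' (hcont v hv).aestronglyMeasurable (ae_of_all _ fun x => ?_)
    simpa using hB (x + v * Complex.I) (by simpa using hv)
  have hrect : ∀ T : ℝ, (∫ x in (-T)..T, f x) - (∫ x in (-T)..T, f (x + y * Complex.I)) =
      Complex.I • (∫ v in (0 : ℝ)..y, f ((-T : ℝ) + v * Complex.I)) -
        Complex.I • (∫ v in (0 : ℝ)..y, f (T + v * Complex.I)) := by
    intro T
    have h := Complex.integral_boundary_rect_eq_zero_of_differentiableOn f (-T : ℝ)
      (T + y * Complex.I) (fun w hw => (hf w ?_).differentiableWithinAt)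
    · simp only [Complex.ofReal_re, Complex.ofReal_im, Complex.add_re, Complex.mul_re,
        Complex.I_re, Complex.I_im, Complex.add_im, Complex.mul_im, mul_zero, mul_one, zero_mul,
        sub_self, add_zero, zero_add, Complex.ofReal_zero] at h
      linear_combination h
    · simpa using hw.2
  -- The vertical sides have fixed length `|y|`, so they vanish with the majorant `B`.
  have hside : ∀ s : ℝ → ℝ, Tendsto (fun T => B (s T)) atTop (𝓝 0) →
      Tendsto (fun T => Complex.I • (∫ v in (0 : ℝ)..y, f (s T + v * Complex.I))) atTop
        (𝓝 0) := by
    intro s hs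
    refine squeeze_zero_norm (a := fun T => B (s T) * |y - 0|) (fun T => ?_)
      (by simpa using hs.mul_const |y - 0|)
    rw [norm_smul, Complex.norm_I, one_mul]
    refine intervalIntegral.norm_integral_le_of_norm_le_const fun v hv => ?_
    simpa using hB (s T + v * Complex.I) (by simpa using uIoc_subset_uIcc hv)
  have hlim : Tendsto (fun T : ℝ => (∫ x in (-T)..T, f x) -
      (∫ x in (-T)..T, f (x + y * Complex.I))) atTop (𝓝 0) := by
    simp_rw [hrect]
    simpa using (hside (fun T => -T) (hBbot.comp tendsto_neg_atTop_atBot)).sub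
      (hside (fun T => T) hBtop)
  have h0 : Integrable fun x : ℝ => f x := by simpa using hint 0 left_mem_uIcc
  have hlim' := (intervalIntegral_tendsto_integral h0 tendsto_neg_atTop_atBot tendsto_id).sub
    (intervalIntegral_tendsto_integral (hint y right_mem_uIcc) tendsto_neg_atTop_atBot tendsto_id)
  exact sub_eq_zero.1 (tendsto_nhds_unique hlim' hlim)

/-! ### Gamma integrals with complex parameter -/

lemma integrableOn_rpow_mul_exp_neg_mul {s b : ℝ} (hs : -1 < s) (hb : 0 < b) :
    IntegrableOn (fun t : ℝ => t ^ s * Real.exp (-(b * t))) (Ioi 0) := by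
  simpa using integrableOn_rpow_mul_exp_neg_mul_rpow hs one_pos hb

lemma norm_rpow_mul_cexp {s t : ℝ} (ht : 0 < t) (w : ℂ) :
    ‖((t ^ s : ℝ) : ℂ) * Complex.exp (-(w * t))‖ = t ^ s * Real.exp (-(w.re * t)) := by
  rw [norm_mul, Complex.norm_real, Real.norm_of_nonneg (by positivity), Complex.norm_exp]
  simp

lemma integrableOn_rpow_mul_cexp {s : ℝ} (hs : -1 < s) {w : ℂ} (hw : 0 < w.re) :
    IntegrableOn (fun t : ℝ => ((t ^ s : ℝ) : ℂ) * Complex.exp (-(w * t))) (Ioi 0) := by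
  refine (integrableOn_rpow_mul_exp_neg_mul hs hw).mono' ?_ ?_
  · exact (Measurable.aestronglyMeasurable (by fun_prop))
  · exact (ae_restrict_mem measurableSet_Ioi).mono fun t ht => (norm_rpow_mul_cexp ht w).le

lemma differentiableAt_integral_rpow_mul_cexp {a : ℝ} (ha : 0 < a) {w : ℂ} (hw : 0 < w.re) :
    DifferentiableAt ℂ
      (fun v : ℂ => ∫ t in Ioi (0 : ℝ), ((t ^ (a - 1) : ℝ) : ℂ) * Complex.exp (-(v * t))) w := by
  have hs : {v : ℂ | w.re / 2 < v.re} ∈ 𝓝 w :=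
    (isOpen_lt continuous_const Complex.continuous_re).mem_nhds (by simpa using hw)
  refine (hasDerivAt_integral_of_dominated_loc_of_deriv_le
    (μ := volume.restrict (Ioi (0 : ℝ)))
    (F := fun v t => ((t ^ (a - 1) : ℝ) : ℂ) * Complex.exp (-(v * t)))
    (F' := fun v t => ((t ^ (a - 1) : ℝ) : ℂ) * (Complex.exp (-(v * t)) * (-(1 * t))))
    (bound := fun t => t ^ a * Real.exp (-(w.re / 2 * t))) hs
    (Eventually.of_forall fun v => Measurable.aestronglyMeasurable (by fun_prop))
    (integrableOn_rpow_mul_cexp (by linarith) hw)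
    (Measurable.aestronglyMeasurable (by fun_prop)) ?_
    (integrableOn_rpow_mul_exp_neg_mul (by linarith) (by linarith)) ?_).2.differentiableAt
  · refine (ae_restrict_mem measurableSet_Ioi).mono fun t ht v hv => ?_
    have ht' : 0 < t := ht
    rw [← mul_assoc, norm_mul, norm_rpow_mul_cexp ht', norm_neg, one_mul, Complex.norm_real,
      Real.norm_of_nonneg ht'.le, mul_right_comm, Real.rpow_sub_one ht'.ne', div_mul_cancel₀ _ ht'.ne']
    have hv' : w.re / 2 < v.re := hv
    gcongr
  · refine ae_of_all _ fun t v _ => ?_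
    exact (((hasDerivAt_id v).mul_const (t : ℂ)).neg.cexp).const_mul _

/-- The Gamma integral with a complex parameter in the right half-plane. -/
lemma integral_rpow_mul_cexp {a : ℝ} (ha : 0 < a) {w : ℂ} (hw : 0 < w.re) :
    ∫ t in Ioi (0 : ℝ), ((t ^ (a - 1) : ℝ) : ℂ) * Complex.exp (-(w * t)) =
      w ^ (-a : ℂ) * Real.Gamma a := by
  have hopen : IsOpen {v : ℂ | 0 < v.re} := isOpen_lt continuous_const Complex.continuous_re
  have hf : AnalyticOnNhd ℂ
      (fun v : ℂ => ∫ t in Ioi (0 : ℝ), ((t ^ (a - 1) : ℝ) : ℂ) * Complex.exp (-(v * t)))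
      {v : ℂ | 0 < v.re} :=
    DifferentiableOn.analyticOnNhd (fun v hv =>
      (differentiableAt_integral_rpow_mul_cexp ha hv).differentiableWithinAt) hopen
  have hg : AnalyticOnNhd ℂ (fun v : ℂ => v ^ (-a : ℂ) * Real.Gamma a) {v : ℂ | 0 < v.re} :=
    DifferentiableOn.analyticOnNhd (fun v hv =>
      ((differentiableAt_id.cpow_const (Or.inl hv)).mul_const _).differentiableWithinAt) hopen
  have hreal : ∀ r : ℝ, 0 < r →
      (∫ t in Ioi (0 : ℝ), ((t ^ (a - 1) : ℝ) : ℂ) * Complex.exp (-(r * t))) =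
        (r : ℂ) ^ (-a : ℂ) * Real.Gamma a := by
    intro r hr
    have h := Real.integral_rpow_mul_exp_neg_mul_Ioi ha hr
    rw [one_div, Real.inv_rpow hr.le, ← Real.rpow_neg hr.le] at h
    have h2 := congrArg (fun x : ℝ => (x : ℂ)) h
    simp only [Complex.ofReal_mul, Complex.ofReal_cpow hr.le, Complex.ofReal_neg] at h2
    rw [← h2, ← integral_complex_ofReal]
    simp
  -- Identity theorem: the two sides agree on the positive reals, which accumulate at `1`.
  have hfreq : ∃ᶠ v in 𝓝[≠] (1 : ℂ),
      (∫ t in Ioi (0 : ℝ), ((t ^ (a - 1) : ℝ) : ℂ) * Complex.exp (-(v * t))) =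
        v ^ (-a : ℂ) * Real.Gamma a := by
    have ht : Tendsto (fun r : ℝ => (r : ℂ)) (𝓝[≠] 1) (𝓝[≠] 1) := by
      refine tendsto_nhdsWithin_iff.2 ⟨?_, ?_⟩
      · exact (Complex.continuous_ofReal.tendsto' 1 1 (by simp)).mono_left nhdsWithin_le_nhds
      · filter_upwards [self_mem_nhdsWithin] with r hr
        simpa using hr
    refine ht.frequently (Eventually.frequently ?_)
    filter_upwards [nhdsWithin_le_nhds (lt_mem_nhds (zero_lt_one' ℝ))] with r hr using hreal r hr
  exact hf.eqOn_of_preconnected_of_frequently_eq hg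
    (convex_halfSpace_re_gt 0).isPreconnected (by simp) hfreq hw

lemma inv_rpow_mul_rpow {a t : ℝ} (ht : 0 < t) :
    t ^ ((-1 : ℝ) - 1) * (t ^ (-1 : ℝ)) ^ (a - 1) = t ^ (-(a + 1)) := by
  rw [← Real.rpow_mul ht.le, ← Real.rpow_add ht]
  ring_nf

/-- The integrand identity for the substitution `t ↦ 1/t`, Jacobian included. -/
lemma smul_comp_inv {a t : ℝ} (ht : 0 < t) (w : ℂ) :
    (|(-1 : ℝ)| * t ^ ((-1 : ℝ) - 1)) •
      ((((t ^ (-1 : ℝ)) ^ (a - 1) : ℝ) : ℂ) * Complex.exp (-(w * (t ^ (-1 : ℝ) : ℝ)))) =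
      ((t ^ (-(a + 1)) : ℝ) : ℂ) * Complex.exp (-(w / t)) := by
  rw [← inv_rpow_mul_rpow ht, Complex.real_smul, abs_neg, abs_one, one_mul, ← mul_assoc,
    ← Complex.ofReal_mul, Real.rpow_neg_one t, Complex.ofReal_inv, div_eq_mul_inv]

lemma integrableOn_rpow_mul_cexp_div {a : ℝ} (ha : 0 < a) {w : ℂ} (hw : 0 < w.re) :
    IntegrableOn (fun t : ℝ => ((t ^ (-(a + 1)) : ℝ) : ℂ) * Complex.exp (-(w / t))) (Ioi 0) := by
  refine IntegrableOn.congr_fun ((integrableOn_Ioi_comp_rpow_iff _ (by norm_num : (-1 : ℝ) ≠ 0)).2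
    (integrableOn_rpow_mul_cexp (s := a - 1) (by linarith) hw)) ?_ measurableSet_Ioi
  exact fun t ht => smul_comp_inv ht w

lemma integral_rpow_mul_cexp_div {a : ℝ} (ha : 0 < a) {w : ℂ} (hw : 0 < w.re) :
    ∫ t in Ioi (0 : ℝ), ((t ^ (-(a + 1)) : ℝ) : ℂ) * Complex.exp (-(w / t)) =
      w ^ (-a : ℂ) * Real.Gamma a := by
  rw [← integral_rpow_mul_cexp ha hw, ← integral_comp_rpow_Ioi
    (fun t : ℝ => ((t ^ (a - 1) : ℝ) : ℂ) * Complex.exp (-(w * t))) (by norm_num : (-1 : ℝ) ≠ 0)]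
  exact setIntegral_congr_fun measurableSet_Ioi fun t ht => (smul_comp_inv ht w).symm

lemma norm_rpow_mul_cexp_div {a t : ℝ} (ht : 0 < t) (w : ℂ) :
    ‖((t ^ (-(a + 1)) : ℝ) : ℂ) * Complex.exp (-(w / t))‖ =
      t ^ (-(a + 1)) * Real.exp (-(w.re / t)) := by
  rw [norm_mul, Complex.norm_real, Real.norm_of_nonneg (by positivity), Complex.norm_exp]
  simp [Complex.div_ofReal_re]

lemma integral_norm_rpow_mul_cexp_div {a : ℝ} (ha : 0 < a) {w : ℂ} (hw : 0 < w.re) :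
    ∫ t in Ioi (0 : ℝ), ‖((t ^ (-(a + 1)) : ℝ) : ℂ) * Complex.exp (-(w / t))‖ =
      w.re ^ (-a) * Real.Gamma a := by
  rw [← Complex.ofReal_inj, Complex.ofReal_mul, Complex.ofReal_cpow hw.le, Complex.ofReal_neg,
    ← integral_rpow_mul_cexp_div ha (w := w.re) (by simpa using hw), ← integral_complex_ofReal]
  refine setIntegral_congr_fun measurableSet_Ioi fun t ht => ?_
  simp only [norm_rpow_mul_cexp_div (show 0 < t from ht) w]
  push_cast
  rfl

/-! ### The Beta integral of a power of `cosh` -/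

lemma sigmoid_mul_one_sub_sigmoid (x : ℝ) :
    Real.sigmoid (2 * x) * (1 - Real.sigmoid (2 * x)) = (4 * Real.cosh x ^ 2)⁻¹ := by
  rw [← Real.sigmoid_neg, Real.sigmoid_def, Real.sigmoid_def, Real.cosh_eq, ← mul_inv, neg_neg]
  congr 1
  have h1 : Real.exp (2 * x) = Real.exp x * Real.exp x := by rw [← Real.exp_add]; ring_nf
  have h2 : Real.exp (-(2 * x)) = Real.exp (-x) * Real.exp (-x) := by
    rw [← Real.exp_add]; ring_nf
  have h3 : Real.exp x * Real.exp (-x) = 1 := by rw [← Real.exp_add]; simp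
  rw [h1, h2]
  linear_combination (Real.exp x * Real.exp (-x) - 1) * h3

lemma hasDerivAt_sigmoid_two_mul (x : ℝ) :
    HasDerivAt (fun x : ℝ => Real.sigmoid (2 * x))
      (Real.sigmoid (2 * x) * (1 - Real.sigmoid (2 * x)) * (2 * 1)) x :=
  (Real.hasDerivAt_sigmoid (2 * x)).comp x ((hasDerivAt_id x).const_mul 2)

lemma image_sigmoid_two_mul : (fun x : ℝ => Real.sigmoid (2 * x)) '' univ = Ioo 0 1 := by
  rw [image_univ, ← Real.range_sigmoid]
  exact (mul_left_surjective₀ (two_ne_zero' ℝ)).range_comp Real.sigmoid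

/-- With `u = sigmoid (2x)` one has `du = 2u(1 - u) dx` and `u(1 - u) = 1 / (4 cosh² x)`, so the
Beta integrand with both parameters `a/2` depends on `cosh x` alone. -/
lemma betaIntegrand_comp_sigmoid {a : ℝ} (x : ℝ) :
    |Real.sigmoid (2 * x) * (1 - Real.sigmoid (2 * x)) * (2 * 1)| •
      (((Real.sigmoid (2 * x) : ℝ) : ℂ) ^ (((a / 2 : ℝ) : ℂ) - 1) *
        (1 - ((Real.sigmoid (2 * x) : ℝ) : ℂ)) ^ (((a / 2 : ℝ) : ℂ) - 1)) =
      ((2 ^ (1 - a) * Real.cosh x ^ (-a) : ℝ) : ℂ) := by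
  have h0 := Real.sigmoid_pos (2 * x)
  have h1 : 0 < 1 - Real.sigmoid (2 * x) := sub_pos.2 (Real.sigmoid_lt_one _)
  have hc := Real.cosh_pos x
  have e : ((a / 2 : ℝ) : ℂ) - 1 = ((a / 2 - 1 : ℝ) : ℂ) := by push_cast; ring
  rw [e, show (1 - ((Real.sigmoid (2 * x) : ℝ) : ℂ)) = ((1 - Real.sigmoid (2 * x) : ℝ) : ℂ) by
    push_cast; ring, ← Complex.ofReal_cpow h0.le, ← Complex.ofReal_cpow h1.le,
    ← Complex.ofReal_mul, Complex.real_smul, ← Complex.ofReal_mul, Complex.ofReal_inj,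
    ← Real.mul_rpow h0.le h1.le, abs_of_pos (by positivity), sigmoid_mul_one_sub_sigmoid,
    show 4 * Real.cosh x ^ 2 = (2 * Real.cosh x) ^ (2 : ℝ) by rw [Real.rpow_two]; ring,
    ← Real.rpow_neg (by positivity), mul_right_comm, ← Real.rpow_mul (by positivity),
    ← Real.rpow_add (by positivity), show -2 + -2 * (a / 2 - 1) = -a by ring,
    Real.mul_rpow two_pos.le hc.le, Real.rpow_sub two_pos, Real.rpow_one,
    Real.rpow_neg two_pos.le]
  ring

lemma integrable_cosh_rpow_neg {a : ℝ} (ha : 0 < a) :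
    Integrable fun x : ℝ => Real.cosh x ^ (-a) := by
  have hu : 0 < (((a / 2 : ℝ) : ℂ)).re := by simpa using ha
  have h := (intervalIntegrable_iff_integrableOn_Ioo_of_le zero_le_one).1
    (Complex.betaIntegral_convergent hu hu)
  rw [← image_sigmoid_two_mul, integrableOn_image_iff_integrableOn_abs_deriv_smul .univ
    (fun x _ => (hasDerivAt_sigmoid_two_mul x).hasDerivWithinAt)
    (fun x _ y _ hxy => by simpa using Real.sigmoid_injective hxy)] at h
  simp only [betaIntegrand_comp_sigmoid, integrableOn_univ] at h
  have h' := h.re.const_mul ((2 : ℝ) ^ (1 - a))⁻¹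
  refine h'.congr (ae_of_all _ fun x => ?_)
  have : (0 : ℝ) < 2 ^ (1 - a) := by positivity
  simp only [RCLike.re_to_complex, Complex.ofReal_re]
  rw [inv_mul_cancel_left₀ this.ne']

/-- The integral of `(cosh x)^(-a)` is a Beta integral, through `u = 1 / (1 + exp (-2x))`. -/
lemma integral_cosh_rpow_neg {a : ℝ} (ha : 0 < a) :
    ∫ x : ℝ, Real.cosh x ^ (-a) = 2 ^ (a - 1) * Real.Gamma (a / 2) ^ 2 / Real.Gamma a := by
  have hu : 0 < (((a / 2 : ℝ) : ℂ)).re := by simpa using ha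
  have h := Complex.betaIntegral_eq_Gamma_mul_div _ _ hu hu
  rw [Complex.betaIntegral, intervalIntegral.integral_of_le zero_le_one,
    integral_Ioc_eq_integral_Ioo, ← image_sigmoid_two_mul,
    integral_image_eq_integral_abs_deriv_smul .univ
    (fun x _ => (hasDerivAt_sigmoid_two_mul x).hasDerivWithinAt)
    (fun x _ y _ hxy => by simpa using Real.sigmoid_injective hxy)] at h
  simp only [betaIntegrand_comp_sigmoid, setIntegral_univ] at h
  rw [integral_complex_ofReal, ← Complex.ofReal_add, Complex.Gamma_ofReal, Complex.Gamma_ofReal,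
    ← Complex.ofReal_mul, ← Complex.ofReal_div, Complex.ofReal_inj, add_halves,
    integral_const_mul] at h
  rw [mul_div_assoc, sq, ← h, ← mul_assoc, ← Real.rpow_add two_pos]
  simp

/-! ### The integrand on the strip and its shift -/

/-- The holomorphic extension of the integrand of the Fourier integral, with `a = |z|²`,
`b = 4 σ` and `c = 1 / (4 (p - 1) t)`. -/
noncomputable def stripIntegrand (α a b c : ℝ) (w : ℂ) : ℂ :=
  sinhc w ^ (-α : ℂ) *
    Complex.exp (-(c * (a * (Complex.cosh w / sinhc w) + Complex.I * b * w)))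

/-- A majorant of `stripIntegrand` on the strip `|Im w| ≤ π / 2`. -/
noncomputable def stripBound (α b c x : ℝ) : ℝ :=
  (Real.cosh (x / 2) / 3) ^ (-α) * Real.exp (c * (|b| * (Real.pi / 2)))

lemma differentiableAt_stripIntegrand (α a b c : ℝ) {w : ℂ} (hw : |w.im| ≤ Real.pi / 2) :
    DifferentiableAt ℂ (stripIntegrand α a b c) w := by
  have hS : DifferentiableAt ℂ sinhc w := differentiable_sinhc w
  have hne := sinhc_ne_zero hw
  unfold stripIntegrand
  refine (hS.cpow_const (sinhc_mem_slitPlane hw)).mul (DifferentiableAt.cexp ?_)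
  have : DifferentiableAt ℂ (fun w => Complex.cosh w / sinhc w) w :=
    Complex.differentiableAt_cosh.div hS hne
  fun_prop

/-- The `a`-term of the exponent only helps, by `cosh_div_sinhc_re_nonneg`; the `b`-term costs at
most `c |b| π/2` on the strip. -/
lemma norm_stripIntegrand_le {α a c : ℝ} (b : ℝ) (hα : 0 ≤ α) (ha : 0 ≤ a) (hc : 0 ≤ c) {w : ℂ}
    (hw : |w.im| ≤ Real.pi / 2) : ‖stripIntegrand α a b c w‖ ≤ stripBound α b c w.re := by
  have hch := Real.cosh_pos (w.re / 2)
  rw [stripIntegrand, stripBound, norm_mul, ← Complex.ofReal_neg, Complex.norm_cpow_real,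
    Complex.norm_exp]
  refine mul_le_mul (Real.rpow_le_rpow_of_nonpos (by positivity) (cosh_half_le_norm_sinhc hw)
    (by linarith)) (Real.exp_le_exp.2 ?_) (Real.exp_pos _).le (by positivity)
  have e : (-((c : ℂ) * (a * (Complex.cosh w / sinhc w) + Complex.I * b * w))).re =
      c * (b * w.im) - c * (a * (Complex.cosh w / sinhc w).re) := by
    simp only [Complex.neg_re, Complex.add_re, Complex.mul_re,
      Complex.mul_im, Complex.I_re, Complex.I_im, Complex.ofReal_re, Complex.ofReal_im]
    ring
  have h1 := cosh_div_sinhc_re_nonneg hw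
  have h2 : b * w.im ≤ |b| * (Real.pi / 2) := by
    refine (le_abs_self _).trans ?_
    rw [abs_mul]
    gcongr
  have h3 : 0 ≤ c * (a * (Complex.cosh w / sinhc w).re) := by positivity
  rw [e]
  nlinarith [mul_le_mul_of_nonneg_left h2 hc]

lemma integrable_cosh_half_rpow_neg {α : ℝ} (hα : 0 < α) {r : ℝ} (hr : 0 < r) :
    Integrable fun x : ℝ => (Real.cosh (x / 2) * r) ^ (-α) := by
  have h := ((integrable_cosh_rpow_neg hα).comp_div (two_ne_zero' ℝ)).mul_const (r ^ (-α))
  refine h.congr (ae_of_all _ fun x => ?_)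
  simp only [Real.mul_rpow (Real.cosh_pos (x / 2)).le hr.le]

lemma integrable_stripBound {α : ℝ} (hα : 0 < α) (b c : ℝ) : Integrable (stripBound α b c) := by
  simpa only [div_eq_mul_inv] using!
    (integrable_cosh_half_rpow_neg hα (r := 3⁻¹) (by norm_num)).mul_const
      (Real.exp (c * (|b| * (Real.pi / 2))))

lemma tendsto_cosh_atTop : Tendsto Real.cosh atTop atTop :=
  tendsto_atTop_mono (fun x => by rw [Real.cosh_eq]; linarith [Real.exp_pos (-x)])
    (Real.tendsto_exp_atTop.atTop_div_const (two_pos (α := ℝ)))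

lemma tendsto_stripBound_atTop {α : ℝ} (hα : 0 < α) (b c : ℝ) :
    Tendsto (stripBound α b c) atTop (𝓝 0) := by
  have h := (tendsto_rpow_neg_atTop hα).comp ((tendsto_cosh_atTop.comp
    (tendsto_id.atTop_div_const (two_pos (α := ℝ)))).atTop_div_const (three_pos (α := ℝ)))
  simpa using! h.mul_const (Real.exp (c * (|b| * (Real.pi / 2))))

lemma tendsto_stripBound_atBot {α : ℝ} (hα : 0 < α) (b c : ℝ) :
    Tendsto (stripBound α b c) atBot (𝓝 0) := by
  refine ((tendsto_stripBound_atTop hα b c).comp tendsto_neg_atBot_atTop).congr fun x => ?_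
  simp [stripBound, neg_div]

lemma integrable_stripIntegrand {α a c : ℝ} (b : ℝ) (hα : 0 < α) (ha : 0 ≤ a) (hc : 0 ≤ c) :
    Integrable fun x : ℝ => stripIntegrand α a b c x := by
  have him (x : ℝ) : |(x : ℂ).im| ≤ Real.pi / 2 := by rw [Complex.ofReal_im, abs_zero]; exact Real.pi_div_two_pos.le
  refine (integrable_stripBound hα b c).mono' ?_ (ae_of_all _ fun x => ?_)
  · refine Continuous.aestronglyMeasurable (continuous_iff_continuousAt.2 fun x => ?_)
    exact ContinuousAt.comp (f := fun x : ℝ => (x : ℂ))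
      (differentiableAt_stripIntegrand α a b c (him x)).continuousAt (by fun_prop)
  · simpa using norm_stripIntegrand_le b hα.le ha hc (him x)

lemma integral_stripIntegrand_shift {α a c y : ℝ} (b : ℝ) (hα : 0 < α) (ha : 0 ≤ a) (hc : 0 ≤ c)
    (hy : |y| ≤ Real.pi / 2) :
    ∫ x : ℝ, stripIntegrand α a b c x =
      ∫ x : ℝ, stripIntegrand α a b c (x + y * Complex.I) := by
  have him {w : ℂ} (hw : w.im ∈ uIcc 0 y) : |w.im| ≤ Real.pi / 2 := by
    have := abs_sub_left_of_mem_uIcc hw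
    simp only [sub_zero] at this
    exact this.trans hy
  exact integral_add_mul_I_eq
    (fun w hw => differentiableAt_stripIntegrand α a b c (him hw))
    (fun w hw => norm_stripIntegrand_le b hα.le ha hc (him hw))
    (integrable_stripBound hα b c) (tendsto_stripBound_atTop hα b c)
    (tendsto_stripBound_atBot hα b c)

/-- On the line through `-i arg (a + i b)` the phase becomes a multiple of `cosh x / sinhc`. -/
lemma stripIntegrand_shift {α c x y R : ℝ} (hy : |y| ≤ Real.pi / 2) :
    stripIntegrand α (R * Real.cos y) (-(R * Real.sin y)) c (x + y * Complex.I) =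
      sinhc (x + y * Complex.I) ^ (-α : ℂ) *
        Complex.exp (-(c * (R * Real.cosh x / sinhc (x + y * Complex.I)))) := by
  set w : ℂ := x + y * Complex.I with hw
  have hwim : w.im = y := by simp [hw]
  have hne : sinhc w ≠ 0 := sinhc_ne_zero (by rwa [hwim])
  rw [stripIntegrand]
  congr 4
  -- After clearing `sinhc w`, this is `R (cos y cosh w - i sin y sinh w) = R cosh (w - iy)`, with
  -- `w - iy = x`.
  rw [eq_div_iff hne, add_mul, mul_assoc, div_mul_cancel₀ _ hne, mul_assoc, mul_comm w,
    sinhc_mul_self, hw, Complex.cosh_add, Complex.sinh_add, Complex.cosh_mul_I, Complex.sinh_mul_I]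
  push_cast
  linear_combination (R * Complex.cosh x : ℂ) * Complex.sin_sq_add_cos_sq y -
    (R * Complex.sin y ^ 2 * Complex.cosh x : ℂ) * Complex.I_sq

/-! ### The double integral in `t` and `x` -/

/-- Principal powers multiply here because `s > 0` and `arg S ≠ π` give `log (s / S) = log s - log
S`. -/
lemma cpow_neg_mul_div_cpow_neg {S : ℂ} (hS : 0 < S.re) {s : ℝ} (hs : 0 < s) (α : ℝ) :
    S ^ (-α : ℂ) * (s / S) ^ (-α : ℂ) = ((s ^ (-α) : ℝ) : ℂ) := by
  have h0 : S ≠ 0 := by rintro rfl; simp at hS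
  have hs0 : (s : ℂ) ≠ 0 := by exact_mod_cast hs.ne'
  have harg : S.arg ≠ Real.pi := Complex.mem_slitPlane_iff_arg.1 (Or.inl hS) |>.1
  rw [Complex.ofReal_cpow hs.le, Complex.cpow_def_of_ne_zero h0,
    Complex.cpow_def_of_ne_zero (div_ne_zero hs0 h0), Complex.cpow_def_of_ne_zero hs0,
    div_eq_mul_inv, Complex.log_ofReal_mul hs (inv_ne_zero h0), Complex.log_inv _ harg,
    ← Complex.exp_add, Complex.ofReal_log hs.le]
  congr 1
  push_cast
  ring

/-- The integrand of the double integral over `t` and the shifted line. -/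
noncomputable def shiftedIntegrand (α r y t x : ℝ) : ℂ :=
  sinhc (x + y * Complex.I) ^ (-α : ℂ) * (((t ^ (-(α + 1)) : ℝ) : ℂ) *
    Complex.exp (-((((r * Real.cosh x : ℝ) : ℂ) / sinhc (x + y * Complex.I)) / t)))

lemma div_sinhc_re_pos {s x y : ℝ} (hs : 0 < s) (hy : |y| ≤ Real.pi / 2) :
    0 < ((s : ℂ) / sinhc (x + y * Complex.I)).re := by
  have h : 0 < (sinhc (x + y * Complex.I)).re := sinhc_re_pos (by simpa using hy)
  rw [div_eq_mul_inv, Complex.re_ofReal_mul, Complex.inv_re]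
  exact mul_pos hs (div_pos h (Complex.normSq_pos.2 fun h0 => by simp [h0] at h))

lemma measurable_shiftedIntegrand (α r y : ℝ) :
    Measurable (Function.uncurry (shiftedIntegrand α r y)) := by
  have hS : Measurable sinhc := differentiable_sinhc.continuous.measurable
  unfold Function.uncurry shiftedIntegrand
  fun_prop

lemma integral_shiftedIntegrand {α r y x : ℝ} (hα : 0 < α) (hr : 0 < r)
    (hy : |y| ≤ Real.pi / 2) :
    ∫ t in Ioi (0 : ℝ), shiftedIntegrand α r y t x =
      (((r * Real.cosh x) ^ (-α) * Real.Gamma α : ℝ) : ℂ) := by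
  have hs : 0 < r * Real.cosh x := mul_pos hr (Real.cosh_pos x)
  simp only [shiftedIntegrand]
  rw [integral_const_mul, integral_rpow_mul_cexp_div hα (div_sinhc_re_pos hs hy), ← mul_assoc,
    cpow_neg_mul_div_cpow_neg (sinhc_re_pos (by simpa using hy)) hs, Complex.ofReal_mul]

lemma integral_norm_shiftedIntegrand {α r y x : ℝ} (hα : 0 < α) (hr : 0 < r)
    (hy : |y| ≤ Real.pi / 2) :
    ∫ t in Ioi (0 : ℝ), ‖shiftedIntegrand α r y t x‖ =
      ‖sinhc (x + y * Complex.I)‖ ^ (-α) *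
        ((((r * Real.cosh x : ℝ) : ℂ) / sinhc (x + y * Complex.I)).re ^ (-α) * Real.Gamma α) := by
  have hs : 0 < r * Real.cosh x := mul_pos hr (Real.cosh_pos x)
  rw [← integral_norm_rpow_mul_cexp_div hα (div_sinhc_re_pos hs hy), ← integral_const_mul]
  refine setIntegral_congr_fun measurableSet_Ioi fun t _ => ?_
  simp only [shiftedIntegrand]
  rw [norm_mul (sinhc _ ^ _), ← Complex.ofReal_neg, Complex.norm_cpow_real]

/-- The `t`-integral of the norm is `Γ(α) (r cosh x · Re S / |S|)^(-α)`, where `S` is `sinhc` on the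
shifted line. Since `Re S / |S| ≥ k / cosh (x / 2)` and `cosh x ≥ cosh² (x / 2)`, it is at most
`Γ(α) (r k cosh (x / 2))^(-α)`, which is integrable. -/
lemma integrable_shiftedIntegrand {α r y : ℝ} (hα : 0 < α) (hr : 0 < r)
    (hy : |y| ≤ Real.pi / 2) :
    Integrable (Function.uncurry (shiftedIntegrand α r y))
      ((volume.restrict (Ioi 0)).prod volume) := by
  have hS : Measurable sinhc := differentiable_sinhc.continuous.measurable
  rw [integrable_prod_iff' (measurable_shiftedIntegrand α r y).aestronglyMeasurable]
  refine ⟨ae_of_all _ fun x => (integrableOn_rpow_mul_cexp_div hα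
    (div_sinhc_re_pos (x := x) (mul_pos hr (Real.cosh_pos x)) hy)).const_mul
      (sinhc (x + y * Complex.I) ^ (-α : ℂ)), ?_⟩
  simp only [Function.uncurry_apply_pair, integral_norm_shiftedIntegrand hα hr hy]
  obtain ⟨k, hk, hle⟩ := exists_le_sinhc_re_div_norm hy
  refine ((integrable_cosh_half_rpow_neg hα (mul_pos hr hk)).mul_const (Real.Gamma α)).mono'
    (Measurable.aestronglyMeasurable (by fun_prop)) (ae_of_all _ fun x => ?_)
  have hre : 0 < (sinhc (x + y * Complex.I)).re := sinhc_re_pos (by simpa using hy)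
  have hw := div_sinhc_re_pos (x := x) (mul_pos hr (Real.cosh_pos x)) hy
  have hn : 0 < ‖sinhc (x + y * Complex.I)‖ :=
    norm_pos_iff.2 fun h0 => by simp [h0] at hre
  have hG := Real.Gamma_pos_of_pos hα
  have hc := Real.cosh_pos x
  have hc2 := Real.cosh_pos (x / 2)
  rw [← mul_assoc, ← Real.mul_rpow hn.le hw.le, Real.norm_of_nonneg (by positivity)]
  refine mul_le_mul_of_nonneg_right
    (Real.rpow_le_rpow_of_nonpos (by positivity) ?_ (by linarith)) hG.le
  have hcosh : Real.cosh (x / 2) ^ 2 ≤ Real.cosh x := by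
    have h1 := Real.cosh_two_mul (x / 2)
    rw [mul_div_cancel₀ _ two_ne_zero] at h1
    nlinarith [sq_nonneg (Real.sinh (x / 2))]
  rw [div_eq_mul_inv (((r * Real.cosh x : ℝ) : ℂ)), Complex.re_ofReal_mul, Complex.inv_re,
    Complex.normSq_eq_norm_sq]
  calc Real.cosh (x / 2) * (r * k) = r * (Real.cosh (x / 2) ^ 2) * (k / Real.cosh (x / 2)) := by
        field_simp
    _ ≤ r * Real.cosh x * ((sinhc (x + y * Complex.I)).re / ‖sinhc (x + y * Complex.I)‖) := by
        exact mul_le_mul (mul_le_mul_of_nonneg_left hcosh hr.le) ((le_div_iff₀ hn).2 (hle x))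
          (by positivity) (by positivity)
    _ = _ := by field_simp

/-! ### Return to the kernel and the constant -/

lemma abs_div_sinh_abs (l : ℝ) : |l| / Real.sinh |l| = l / Real.sinh l := by
  rcases abs_choice l with h | h <;> simp [h, neg_div_neg_eq]

lemma abs_div_tanh_abs (l : ℝ) : |l| / Real.tanh |l| = l / Real.tanh l := by
  rcases abs_choice l with h | h <;> simp [h, neg_div_neg_eq]

lemma kernelIntegrand_eq_stripIntegrand {n : ℕ} (p : ℝ) (z : Horizontal n) (σ t : ℝ) {l : ℝ}
    (hl : l ≠ 0) :
    kernelIntegrand p z σ t l =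
      stripIntegrand ((homDim n - p) / (2 * (p - 1))) (‖z‖ ^ 2) (4 * σ) (1 / (4 * (p - 1) * t))
        l := by
  have hlc : (l : ℂ) ≠ 0 := by exact_mod_cast hl
  have hS : sinhc l = ((Real.sinh l / l : ℝ) : ℂ) := by
    rw [sinhc_of_ne_zero hlc]; push_cast; rfl
  have hpos : 0 < Real.sinh l / l := by
    have h := sinhc_re_pos (w := l) (by rw [Complex.ofReal_im, abs_zero]; exact Real.pi_div_two_pos.le)
    rwa [hS, Complex.ofReal_re] at h
  rw [kernelIntegrand, stripIntegrand, abs_div_sinh_abs, abs_div_tanh_abs, hS,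
    ← Complex.ofReal_neg, ← Complex.ofReal_cpow hpos.le, Real.rpow_neg hpos.le,
    ← Real.inv_rpow hpos.le, inv_div, mul_right_comm, mul_comm, Complex.ofReal_exp,
    ← Complex.exp_add]
  congr 2
  rw [Real.tanh_eq_sinh_div_cosh]
  push_cast
  simp only [div_eq_mul_inv, mul_inv, inv_inv]
  ring

lemma kernelIntegrand_ae_eq {n : ℕ} (p : ℝ) (z : Horizontal n) (σ t : ℝ) :
    kernelIntegrand p z σ t =ᵐ[volume] fun l : ℝ =>
      stripIntegrand ((homDim n - p) / (2 * (p - 1))) (‖z‖ ^ 2) (4 * σ) (1 / (4 * (p - 1) * t))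
        l := by
  -- At `l = 0` the two sides may differ, because of division by zero on the left.
  filter_upwards [compl_mem_ae_iff.2 (measure_singleton (0 : ℝ))] with l hl
  exact kernelIntegrand_eq_stripIntegrand p z σ t hl

lemma kernel_eq_integral_shiftedIntegrand {n : ℕ} {p : ℝ} (hp : 1 < p) (hpQ : p < homDim n)
    (z : Horizontal n) {σ t R y : ℝ} (ht : 0 < t) (hy : |y| ≤ Real.pi / 2)
    (hz : ‖z‖ ^ 2 = R * Real.cos y) (hσ : 4 * σ = -(R * Real.sin y)) :
    kernel p z σ t = ∫ x : ℝ,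
      shiftedIntegrand ((homDim n - p) / (2 * (p - 1))) (R / (4 * (p - 1))) y t x := by
  have hp1 : 0 < p - 1 := sub_pos.2 hp
  have hα : 0 < (homDim n - p) / (2 * (p - 1)) := div_pos (sub_pos.2 hpQ) (by positivity)
  rw [kernel, integral_congr_ae (kernelIntegrand_ae_eq p z σ t),
    integral_stripIntegrand_shift (4 * σ) hα (by positivity) (by positivity) hy,
    ← integral_const_mul]
  refine integral_congr_ae (ae_of_all _ fun x => ?_)
  -- The prefactor is exactly `t^(-(α + 1))`, the power required by the Gamma integral.
  have he : (homDim n + p - 2) / (2 * (p - 1)) = (homDim n - p) / (2 * (p - 1)) + 1 := by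
    field_simp
    ring
  simp only [shiftedIntegrand, hz, hσ, stripIntegrand_shift hy, he]
  rw [mul_left_comm]
  congr 4
  push_cast
  have : (t : ℂ) ≠ 0 := by exact_mod_cast ht.ne'
  simp only [div_eq_mul_inv, mul_inv]
  ring

lemma integral_integral_shiftedIntegrand {α r y : ℝ} (hα : 0 < α) (hr : 0 < r)
    (hy : |y| ≤ Real.pi / 2) :
    ∫ t in Ioi (0 : ℝ), ∫ x : ℝ, shiftedIntegrand α r y t x =
      ((r ^ (-α) * (2 ^ (α - 1) * Real.Gamma (α / 2) ^ 2) : ℝ) : ℂ) := by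
  rw [integral_integral_swap (integrable_shiftedIntegrand hα hr hy)]
  simp only [integral_shiftedIntegrand hα hr hy]
  rw [integral_complex_ofReal, Complex.ofReal_inj, integral_mul_const]
  simp only [Real.mul_rpow hr.le (Real.cosh_pos _).le]
  rw [integral_const_mul, integral_cosh_rpow_neg hα]
  have := (Real.Gamma_pos_of_pos hα).ne'
  field_simp

lemma potentialConst_pos {n : ℕ} {p : ℝ} (hp : 1 < p) (hpQ : p < homDim n) :
    0 < potentialConst n p := by
  have hp1 : 0 < p - 1 := sub_pos.2 hp
  have hα : 0 < (homDim n - p) / (2 * (p - 1)) := div_pos (sub_pos.2 hpQ) (by positivity)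
  have := Real.Gamma_pos_of_pos (half_pos hα)
  unfold potentialConst
  positivity

/-- The gauge is `R^(1/2)` and its exponent is `-2α`; the constant comes from `4^α · 2^(α - 1) =
2^(3α - 1)`. -/
lemma potentialConst_mul_gauge_rpow {n : ℕ} {p : ℝ} (hp : 1 < p) (z : Horizontal n) (σ : ℝ)
    {R α : ℝ} (hα : α = (homDim n - p) / (2 * (p - 1))) (hR : 0 < R)
    (hRsq : R ^ 2 = ‖z‖ ^ 4 + 16 * |σ| ^ 2) :
    potentialConst n p * gauge z σ ^ (-((homDim n - p) / (p - 1))) =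
      (R / (4 * (p - 1))) ^ (-α) * (2 ^ (α - 1) * Real.Gamma (α / 2) ^ 2) := by
  have hp1 : 0 < p - 1 := sub_pos.2 hp
  have hg : gauge z σ ^ (-((homDim n - p) / (p - 1))) = R ^ (-α) := by
    rw [gauge, ← hRsq, ← Real.rpow_natCast, ← Real.rpow_mul hR.le, ← Real.rpow_mul hR.le, hα]
    congr 1
    field_simp
    push_cast
    ring
  have h4 : (4 : ℝ) ^ (-α) = 2 ^ (-(2 * α)) := by
    rw [show (4 : ℝ) = 2 ^ (2 : ℝ) by norm_num, ← Real.rpow_mul two_pos.le]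
    ring_nf
  have h2 : (2 : ℝ) ^ (3 * α - 1) = 2 ^ (2 * α) * 2 ^ (α - 1) := by
    rw [← Real.rpow_add two_pos]
    ring_nf
  rw [hg, potentialConst, ← hα, Real.div_rpow hR.le (by positivity),
    Real.mul_rpow (by norm_num) hp1.le, h4, h2, Real.rpow_neg two_pos.le, Real.rpow_neg hp1.le]
  field_simp

end Heisenberg

open Heisenberg

theorem proposition4p1 (n : ℕ) (hn : 1 ≤ n) (p : ℝ) (hp : 1 < p)
    (hpQ : p < Heisenberg.homDim n) :
    0 < Heisenberg.potentialConst n p ∧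
    ∀ (z : Heisenberg.Horizontal n) (σ : ℝ), (z, σ) ≠ (0, 0) →
      (∀ t : ℝ, 0 < t → Integrable (Heisenberg.kernelIntegrand p z σ t)) ∧
      IntegrableOn (fun t : ℝ => Heisenberg.kernel p z σ t) (Ioi 0) ∧
      ∫ t in Ioi (0 : ℝ), Heisenberg.kernel p z σ t =
        ((Heisenberg.potentialConst n p
          * Heisenberg.gauge z σ ^ (-((Heisenberg.homDim n - p) / (p - 1))) : ℝ) : ℂ) := by
  refine ⟨potentialConst_pos hp hpQ, fun z σ hzσ => ?_⟩
  have hp1 : 0 < p - 1 := sub_pos.2 hp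
  have hα : 0 < (homDim n - p) / (2 * (p - 1)) := div_pos (sub_pos.2 hpQ) (by positivity)
  -- `|v|` is the square of the gauge, and `Re v ≥ 0` keeps the shift `-arg v` within the closed
  -- strip; for `z = 0` it lies on the boundary.
  set v : ℂ := ⟨‖z‖ ^ 2, 4 * σ⟩ with hv
  have hv0 : v ≠ 0 := by
    intro h
    have h1 : ‖z‖ ^ 2 = 0 := congrArg Complex.re h
    have h2 : 4 * σ = 0 := congrArg Complex.im h
    refine hzσ (Prod.ext ?_ ?_)
    · simpa using h1
    · simpa using h2
  have hR : 0 < ‖v‖ := norm_pos_iff.2 hv0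
  have hr : 0 < ‖v‖ / (4 * (p - 1)) := by positivity
  have hy : |-v.arg| ≤ Real.pi / 2 := by
    rw [abs_neg, Complex.abs_arg_le_pi_div_two_iff]
    exact sq_nonneg ‖z‖
  have hcos : ‖z‖ ^ 2 = ‖v‖ * Real.cos (-v.arg) := by
    rw [Real.cos_neg, Complex.norm_mul_cos_arg]
  have hsin : 4 * σ = -(‖v‖ * Real.sin (-v.arg)) := by
    rw [Real.sin_neg, mul_neg, neg_neg, Complex.norm_mul_sin_arg]
  have hker : EqOn (fun t : ℝ => kernel p z σ t) (fun t : ℝ => ∫ x : ℝ, shiftedIntegrand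
      ((homDim n - p) / (2 * (p - 1))) (‖v‖ / (4 * (p - 1))) (-v.arg) t x) (Ioi 0) :=
    fun t ht => kernel_eq_integral_shiftedIntegrand hp hpQ z ht hy hcos hsin
  refine ⟨fun t ht => ?_, ?_, ?_⟩
  · exact (integrable_stripIntegrand (4 * σ) hα (by positivity) (by positivity)).congr
      (kernelIntegrand_ae_eq p z σ t).symm
  · exact IntegrableOn.congr_fun (integrable_shiftedIntegrand hα hr hy).integral_prod_left
      hker.symm measurableSet_Ioi
  · rw [setIntegral_congr_fun measurableSet_Ioi hker,
      integral_integral_shiftedIntegrand hα hr hy,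
      potentialConst_mul_gauge_rpow hp z σ rfl hR]
    rw [← Complex.normSq_eq_norm_sq, Complex.normSq_apply, sq_abs]
    simp only [hv]
    ring
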